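/- Let $A,F,Q\in\mathbb R^{n\times n}$ with $F$ and $Q$ symmetric positive definite, and let $F=LL^\top$ (for instance the Cholesky factorization). Let $\mathcal R(X)=A^\top X+XA-XFX+Q$, and assume that the numerical range $\mathcal W(L^{-1}AL)=\{x^HL^{-1}ALx:\ x\in\mathbb C^n,\ \|x\|_2=1\}$ is contained in $\{\Re z<0\}$. A real matrix is called stable if all its eigenvalues have negative real part; a stabilizing solution of the CARE $\mathcal R(X)=0$ is a solution $X$ for which $A-FX$ is stable. For an integer $s\ge 0$, let $\mathcal T_s(M)$ be the matrix obtained from $M$ by replacing the entries with $|i-j|>s$ by $0$. Let $\widetilde X_0$ be symmetric positive semidefinite with $A-F\widetilde X_0$ stable. Let $\{\widetilde X_k\}_{k\ge0}$ be generated from $\widetilde X_0$ by the truncated inexact Newton-Kleinman iteration (TINK), run without stopping test. In step $k$, put $\widetilde A_{cl,k}=A-F\widetilde X_k$: 1. $\widehat X_{k+1}$ is the result of $it_k\ge 0$ steps of GMRES with zero initial guess, applied to the (vectorized) Lyapunov equation $\widetilde A_{cl,k}^\top X+X\widetilde A_{cl,k}=-(\widetilde X_kF\widetilde X_k+Q)$;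 2. if line search is used, $\lambda_k\in(0,1)$ satisfies $\|\mathcal R((1-\lambda_k)\widetilde X_k+\lambda_k\widehat X_{k+1})\|_2\le(1-\lambda_k\alpha)\|\mathcal R(\widetilde X_k)\|_2$, with a fixed $\alpha>0$; otherwise $\lambda_k=1$; 3. $\widetilde X_{k+1}=\mathcal T_{s_k}\big((1-\lambda_k)\widetilde X_k+\lambda_k\widehat X_{k+1}\big)$ with an integer $s_k\ge 0$. The numbers $it_k$ may be arbitrary. Assume that there is $\overline\lambda>0$ with $\lambda_k\ge\overline\lambda$ for all $k$, and that there is $\zeta\in(0,1)$ such that for all $k\ge 0$ $$\|\mathcal R(\widetilde X_{k+1})\|_2\le(1-\zeta)\,\|\mathcal R(\widetilde X_k)\|_2,$$ $$\|\widetilde A_{cl,k}^\top\widetilde X_{k+1}+\widetilde X_{k+1}\widetilde A_{cl,k}+\widetilde X_kF\widetilde X_k+Q\|_2\le\lambda_{\min}(Q).$$ Then the CARE $\mathcal R(X)=0$ has a unique stabilizing solution $X^*$, it is symmetric positive definite, and $\widetilde X_k\to X^*$ as $k\to\infty$. -/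

import Mathlib

open Filter Topology Matrix
open scoped Kronecker

namespace TINK

/-- The numerical range `{xᴴ M x : x ∈ ℂⁿ, ‖x‖₂ = 1}` of a real square matrix. -/
def numericalRange {n : ℕ} (M : Matrix (Fin n) (Fin n) ℝ) : Set ℂ :=
  {z | ∃ x : EuclideanSpace ℂ (Fin n), ‖x‖ = 1 ∧
    z = star x.ofLp ⬝ᵥ (M.map Complex.ofReal *ᵥ x.ofLp)}

/-- A real square matrix is stable if its complex eigenvalues lie in the open left half-plane. -/
def IsStable {n : ℕ} (M : Matrix (Fin n) (Fin n) ℝ) : Prop :=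
  ∀ μ ∈ spectrum ℂ (M.map Complex.ofReal), μ.re < 0

/-- The smallest eigenvalue of a real symmetric matrix (of positive size). -/
noncomputable def lambdaMin {n : ℕ} (M : Matrix (Fin n) (Fin n) ℝ) : ℝ :=
  sInf (spectrum ℝ M)

/-- The spectral norm `‖M‖₂`, the operator norm induced by the Euclidean norm. -/
noncomputable def norm2 {n : ℕ} (M : Matrix (Fin n) (Fin n) ℝ) : ℝ :=
  ‖Matrix.toEuclideanCLM (n := Fin n) (𝕜 := ℝ) M‖

/-- The Riccati operator `R(X) = Aᵀ X + X A - X F X + Q`. -/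
def riccati {n : ℕ} (A F Q X : Matrix (Fin n) (Fin n) ℝ) : Matrix (Fin n) (Fin n) ℝ :=
  Aᵀ * X + X * A - X * F * X + Q

/-- The closed-loop matrix `A - F X`. -/
def closedLoop {n : ℕ} (A F X : Matrix (Fin n) (Fin n) ℝ) : Matrix (Fin n) (Fin n) ℝ :=
  A - F * X

/-- `X` solves the continuous-time algebraic Riccati equation `R(X) = 0` and is stabilizing. -/
def IsStabilizingSolution {n : ℕ} (A F Q X : Matrix (Fin n) (Fin n) ℝ) : Prop :=
  riccati A F Q X = 0 ∧ IsStable (closedLoop A F X)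

/-- The residual of `Y` in the Lyapunov equation for the Newton step at `X`:
`(A - F X)ᵀ Y + Y (A - F X) + X F X + Q`. -/
def lyapunovResidual {n : ℕ} (A F Q X Y : Matrix (Fin n) (Fin n) ℝ) :
    Matrix (Fin n) (Fin n) ℝ :=
  (closedLoop A F X)ᵀ * Y + Y * closedLoop A F X + X * F * X + Q

/-- The `n² × n²` matrix of the Lyapunov operator `Y ↦ Cᵀ Y + Y C`, for the vectorization `vec`
that stacks the columns. -/
def lyapunovMatrix {n : ℕ} (C : Matrix (Fin n) (Fin n) ℝ) :
    Matrix (Fin n × Fin n) (Fin n × Fin n) ℝ :=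
  (1 : Matrix (Fin n) (Fin n) ℝ) ⊗ₖ Cᵀ + Cᵀ ⊗ₖ (1 : Matrix (Fin n) (Fin n) ℝ)

theorem lyapunovMatrix_mulVec_vec {n : ℕ} (C Y : Matrix (Fin n) (Fin n) ℝ) :
    lyapunovMatrix C *ᵥ vec Y = vec (Cᵀ * Y + Y * C) := by
  simp [lyapunovMatrix, Matrix.add_mulVec, Matrix.kronecker_mulVec_vec]

/-- The Krylov subspace spanned by `b, M b, …, M^(m-1) b`. -/
def krylov {ι : Type*} [Fintype ι] [DecidableEq ι] (M : Matrix ι ι ℝ) (b : ι → ℝ) (m : ℕ) :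
    Submodule ℝ (ι → ℝ) :=
  Submodule.span ℝ (Set.range fun j : Fin m => (M ^ (j : ℕ)) *ᵥ b)

/-- `x` is the result of `m` steps of GMRES on `M x = b` with zero initial guess: it minimizes
the Euclidean norm of the residual over the `m`-th Krylov subspace. -/
def IsGMRESIterate {ι : Type*} [Fintype ι] [DecidableEq ι] (M : Matrix ι ι ℝ) (b : ι → ℝ)
    (m : ℕ) (x : ι → ℝ) : Prop :=
  x ∈ krylov M b m ∧ ∀ y ∈ krylov M b m,
    ‖WithLp.toLp 2 (b - M *ᵥ x)‖ ≤ ‖WithLp.toLp 2 (b - M *ᵥ y)‖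

/-- The banded truncation: entries with `|i - j| ≤ s` are kept, the others are set to zero. -/
def bandTruncation {n : ℕ} (s : ℕ) (M : Matrix (Fin n) (Fin n) ℝ) :
    Matrix (Fin n) (Fin n) ℝ :=
  Matrix.of fun i j => if |((i : ℕ) : ℤ) - ((j : ℕ) : ℤ)| ≤ (s : ℤ) then M i j else 0

/-- An infinite run of the truncated inexact Newton-Kleinman iteration (no stopping test) with
iterates `X k`, where `it k` is the number of GMRES steps, `Xhat (k + 1)` the GMRES result,
`lam k` the step length and `s k` the truncation parameter in step `k`. If `linesearch` is
`true`, every `lam k` satisfies the line search condition with parameter `α`; otherwise it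
is `1`. The conditions by which the `s k` are selected are not part of this predicate. -/
structure IsRun {n : ℕ} (A F Q X₀ : Matrix (Fin n) (Fin n) ℝ) (linesearch : Bool) (α : ℝ)
    (it s : ℕ → ℕ) (lam : ℕ → ℝ) (Xhat X : ℕ → Matrix (Fin n) (Fin n) ℝ) : Prop where
  init : X 0 = X₀
  gmres : ∀ k, IsGMRESIterate (lyapunovMatrix (closedLoop A F (X k)))
    (-vec (X k * F * X k + Q)) (it k) (vec (Xhat (k + 1)))
  search : linesearch = true → ∀ k, 0 < lam k ∧ lam k < 1 ∧
    norm2 (riccati A F Q ((1 - lam k) • X k + lam k • Xhat (k + 1))) ≤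
      (1 - lam k * α) * norm2 (riccati A F Q (X k))
  noSearch : linesearch = false → ∀ k, lam k = 1
  update : ∀ k, X (k + 1) = bandTruncation (s k) ((1 - lam k) • X k + lam k • Xhat (k + 1))

end TINK

/-!
The congruence `X ↦ Lᵀ X L` turns the Riccati operator with data `A`, `F = L Lᵀ`, `Q` into the one
with data `B = L⁻¹ A L`, `1`, `Lᵀ Q L`, and the hypothesis on the numerical range says that
`-(B + Bᵀ)` is positive definite. Subtracting a positive semidefinite `X` from `B` preserves this
property, which makes all closed-loop matrices stable and propagates positive semidefiniteness from
`X k` to `X (k + 1)`: the next iterate satisfies a Lyapunov equation whose right-hand side is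
negative semidefinite, because its residual is at most `λ_min(Q)`. Taking the trace of the Riccati
operator bounds the iterates in terms of its values, which tend to `0`. So the iterates stay in a
compact set, every cluster point is a positive semidefinite stabilizing solution, and there is only
one such solution.
-/

namespace TINK

section Lyapunov

open scoped ComplexOrder

variable {ι 𝕜 : Type*} [Fintype ι] [RCLike 𝕜]

theorem re_neg_of_mem_spectrum [DecidableEq ι] {M : Matrix ι ι 𝕜} (hM : (-(M + Mᴴ)).PosDef) {μ : 𝕜}
    (hμ : μ ∈ spectrum 𝕜 M) : RCLike.re μ < 0 := by
  rw [← spectrum_toLin', ← Module.End.hasEigenvalue_iff_mem_spectrum] at hμ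
  obtain ⟨v, hv⟩ := hμ.exists_hasEigenvector
  have hMv : M *ᵥ v = μ • v := by simpa using hv.apply_eq_smul
  have hform : star v ⬝ᵥ (-(M + Mᴴ)) *ᵥ v = -(μ + star μ) * (star v ⬝ᵥ v) := by
    rw [neg_mulVec, add_mulVec, dotProduct_neg, dotProduct_add, dotProduct_mulVec _ Mᴴ,
      ← star_mulVec, hMv, star_smul, dotProduct_smul, smul_dotProduct, smul_eq_mul, smul_eq_mul]
    ring
  have hneg := hM.dotProduct_mulVec_pos hv.2
  rw [hform] at hneg
  have hvv : 0 < star v ⬝ᵥ v := by simpa using PosDef.one.dotProduct_mulVec_pos hv.2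
  have hre := (RCLike.pos_iff.mp (pos_of_mul_pos_left hneg hvv.le)).1
  rw [map_neg, map_add, RCLike.star_def, RCLike.conj_re] at hre
  linarith

theorem posSemidef_of_lyapunov {C Y : Matrix ι ι 𝕜} (hC : (-(C + Cᴴ)).PosDef)
    (hY : Y.IsHermitian) (h : (-(Cᴴ * Y + Y * C)).PosSemidef) : Y.PosSemidef := by
  classical
  refine hY.posSemidef_iff_eigenvalues_nonneg.mpr fun i => ?_
  set v : ι → 𝕜 := (hY.eigenvectorBasis i).ofLp
  set θ : ℝ := hY.eigenvalues i
  have hv : v ≠ 0 := fun hv0 =>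
    hY.eigenvectorBasis.orthonormal.ne_zero i (WithLp.ofLp_injective 2 hv0)
  have hYv : Y *ᵥ v = θ • v := hY.mulVec_eigenvectorBasis i
  have hvY : star v ᵥ* Y = θ • star v := by
    rw [← hY.eq, ← star_mulVec, hYv, star_smul, star_trivial]
  have hform : star v ⬝ᵥ (-(Cᴴ * Y + Y * C)) *ᵥ v = θ • (star v ⬝ᵥ (-(C + Cᴴ)) *ᵥ v) := by
    simp only [neg_mulVec, add_mulVec, ← mulVec_mulVec, dotProduct_neg, dotProduct_add, hYv,
      mulVec_smul, dotProduct_smul, dotProduct_mulVec _ Y, hvY, smul_dotProduct, smul_neg, smul_add,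
      add_comm]
  have hnonneg := h.re_dotProduct_nonneg v
  rw [hform, RCLike.smul_re] at hnonneg
  exact nonneg_of_mul_nonneg_left hnonneg (hC.re_dotProduct_pos hv)

open scoped MatrixOrder in
theorem trace_mul_nonneg_of_posSemidef {P Y : Matrix ι ι 𝕜} (hP : P.PosSemidef)
    (hY : Y.PosSemidef) : 0 ≤ (P * Y).trace := by
  classical
  obtain ⟨Z, rfl⟩ := CStarAlgebra.nonneg_iff_eq_star_mul_self.mp hY.nonneg
  rw [← Matrix.mul_assoc, trace_mul_comm, ← Matrix.mul_assoc]
  exact (hP.mul_mul_conjTranspose_same Z).trace_nonneg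

open scoped MatrixOrder in
theorem posDef_map_algebraMap {ι : Type*} [Finite ι] {P : Matrix ι ι ℝ} (hP : P.PosDef) :
    (P.map (algebraMap ℝ 𝕜)).PosDef := by
  classical
  cases nonempty_fintype ι
  obtain ⟨Z, hZ, rfl⟩ := CStarAlgebra.isStrictlyPositive_iff_eq_star_mul_self.mp
    hP.isStrictlyPositive
  set Z' := (algebraMap ℝ 𝕜).mapMatrix Z
  have hZ' : IsUnit Z' := hZ.map _
  have hstar : (star Z * Z).map (algebraMap ℝ 𝕜) = star Z' * 1 * Z' := by
    rw [mul_one, Matrix.map_mul, star_eq_conjTranspose, star_eq_conjTranspose]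
    exact congrArg (· * Z') (conjTranspose_map _ fun x => by simp)
  rw [hstar, hZ'.posDef_star_left_conjugate_iff]
  exact PosDef.one

end Lyapunov

section Sylvester

variable {m n K : Type*} [Fintype m] [DecidableEq m] [Fintype n] [DecidableEq n] [Field K]

theorem aeval_mul_eq_mul_aeval {S : Matrix m m K} {T : Matrix n n K} {D : Matrix m n K}
    (h : S * D = D * T) (p : Polynomial K) :
    Polynomial.aeval S p * D = D * Polynomial.aeval T p := by
  have hpow (k : ℕ) : S ^ k * D = D * T ^ k := by
    induction k with
    | zero => simp
    | succ k ih =>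
      rw [pow_succ, Matrix.mul_assoc, h, ← Matrix.mul_assoc, ih, Matrix.mul_assoc, ← pow_succ]
  induction p using Polynomial.induction_on' with
  | add p q hp hq => simp only [map_add, Matrix.add_mul, Matrix.mul_add, hp, hq]
  | monomial k a => simp [Polynomial.aeval_monomial, Algebra.algebraMap_eq_smul_one, hpow]

theorem eq_zero_of_mul_eq_mul_of_disjoint_spectrum [IsAlgClosed K] {S : Matrix m m K}
    {T : Matrix n n K} {D : Matrix m n K} (hST : Disjoint (spectrum K S) (spectrum K T))
    (h : S * D = D * T) : D = 0 := by
  have hunit : IsUnit (Polynomial.aeval T S.charpoly) := by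
    by_contra hsing
    rw [(IsAlgClosed.splits S.charpoly).eq_prod_roots_of_monic S.charpoly_monic] at hsing
    obtain ⟨μ, hμT, hμS⟩ := spectrum.exists_mem_of_not_isUnit_aeval_prod hsing
    exact hST.notMem_of_mem_right hμT (mem_spectrum_iff_isRoot_charpoly.mpr hμS)
  have hannihilate : D * Polynomial.aeval T S.charpoly = 0 := by
    rw [← aeval_mul_eq_mul_aeval h, aeval_self_charpoly, Matrix.zero_mul]
  obtain ⟨u, hu⟩ := hunit
  rw [← hu] at hannihilate
  simpa [Matrix.mul_assoc] using congrArg (· * (↑u⁻¹ : Matrix n n K)) hannihilate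

end Sylvester

section Krylov

variable {ι : Type*} [Fintype ι] [DecidableEq ι]

theorem krylov_le {M : Matrix ι ι ℝ} {b : ι → ℝ} {p : Submodule ℝ (ι → ℝ)} (hb : b ∈ p)
    (hM : ∀ x ∈ p, M *ᵥ x ∈ p) (m : ℕ) : krylov M b m ≤ p := by
  refine Submodule.span_le.mpr (Set.range_subset_iff.mpr fun j => ?_)
  induction (j : ℕ) with
  | zero => simpa using hb
  | succ k ih => rw [pow_succ', ← mulVec_mulVec]; exact hM _ ih

/-- The vectorizations of the symmetric matrices: `vec Z` is indexed by pairs, and transposing `Z`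
swaps the two components of the index. -/
def symmetricVec (ι : Type*) : Submodule ℝ (ι × ι → ℝ) :=
  LinearMap.eqLocus (LinearMap.funLeft ℝ ℝ Prod.swap) LinearMap.id

theorem vec_mem_symmetricVec {ι : Type*} {Z : Matrix ι ι ℝ} :
    vec Z ∈ symmetricVec ι ↔ Z.IsSymm := by
  rw [symmetricVec, LinearMap.mem_eqLocus]
  exact vec_inj (A := Zᵀ)

theorem isSymm_of_vec_mem_krylov {n m : ℕ} {C P Y : Matrix (Fin n) (Fin n) ℝ} (hP : P.IsSymm)
    (hY : vec Y ∈ krylov (lyapunovMatrix C) (vec P) m) : Y.IsSymm := by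
  refine vec_mem_symmetricVec.mp (krylov_le (vec_mem_symmetricVec.mpr hP) (fun x hx => ?_) m hY)
  obtain ⟨Z, rfl⟩ := vec_bijective.surjective x
  have hZ : Z.IsSymm := vec_mem_symmetricVec.mp hx
  rw [lyapunovMatrix_mulVec_vec, vec_mem_symmetricVec]
  simp [Matrix.IsSymm, hZ.eq, add_comm]

theorem isSymm_bandTruncation {n : ℕ} (s : ℕ) {M : Matrix (Fin n) (Fin n) ℝ} (hM : M.IsSymm) :
    (bandTruncation s M).IsSymm := by
  ext i j
  simp [bandTruncation, abs_sub_comm, hM.apply]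

theorem IsRun.isSymm {n : ℕ} {A F Q X₀ : Matrix (Fin n) (Fin n) ℝ} {linesearch : Bool} {α : ℝ}
    {it s : ℕ → ℕ} {lam : ℕ → ℝ} {Xhat X : ℕ → Matrix (Fin n) (Fin n) ℝ}
    (hrun : IsRun A F Q X₀ linesearch α it s lam Xhat X) (hF : F.IsSymm) (hQ : Q.IsSymm)
    (hX₀ : X₀.IsSymm) (k : ℕ) : (X k).IsSymm := by
  induction k with
  | zero => rwa [hrun.init]
  | succ k ih =>
    have hrhs : (-(X k * F * X k + Q)).IsSymm := by
      simp [Matrix.IsSymm, ih.eq, hF.eq, hQ.eq, Matrix.mul_assoc]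
    have hXhat : (Xhat (k + 1)).IsSymm :=
      isSymm_of_vec_mem_krylov hrhs (vec_neg (X k * F * X k + Q) ▸ (hrun.gmres k).1)
    rw [hrun.update]
    exact isSymm_bandTruncation _ ((ih.smul _).add (hXhat.smul _))

end Krylov

section NumericalRange

variable {n : ℕ} {M : Matrix (Fin n) (Fin n) ℝ}

theorem isStable_of_posDef_neg_add_transpose (hM : (-(M + Mᵀ)).PosDef) : IsStable M := by
  intro μ hμ
  refine re_neg_of_mem_spectrum ?_ hμ
  have h := posDef_map_algebraMap (𝕜 := ℂ) hM
  convert h using 1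
  ext i j
  simp

theorem dotProduct_mulVec_mem_numericalRange {y : Fin n → ℝ} (hy : y ⬝ᵥ y = 1) :
    ((y ⬝ᵥ M *ᵥ y : ℝ) : ℂ) ∈ numericalRange M := by
  refine ⟨WithLp.toLp 2 fun i => (y i : ℂ), ?_, by simp [dotProduct, mulVec]⟩
  simpa [EuclideanSpace.norm_eq, dotProduct, pow_two] using hy

theorem posDef_neg_add_transpose_of_numericalRange (h : ∀ z ∈ numericalRange M, z.re < 0) :
    (-(M + Mᵀ)).PosDef := by
  refine .of_dotProduct_mulVec_pos (by simp [Matrix.IsHermitian, add_comm]) fun x hx => ?_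
  have hxx : 0 < x ⬝ᵥ x := by simpa using PosDef.one.dotProduct_mulVec_pos hx
  have hunit : ((√(x ⬝ᵥ x))⁻¹ • x) ⬝ᵥ ((√(x ⬝ᵥ x))⁻¹ • x) = 1 := by
    rw [smul_dotProduct, dotProduct_smul, smul_eq_mul, smul_eq_mul, ← mul_assoc, ← mul_inv,
      Real.mul_self_sqrt hxx.le, inv_mul_cancel₀ hxx.ne']
  have hneg := h _ (dotProduct_mulVec_mem_numericalRange hunit)
  rw [Complex.ofReal_re, mulVec_smul, smul_dotProduct, dotProduct_smul, smul_eq_mul,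
    smul_eq_mul, ← mul_assoc] at hneg
  have hxMx : x ⬝ᵥ M *ᵥ x < 0 := neg_of_mul_neg_right hneg (mul_self_nonneg _)
  have hsymm : x ⬝ᵥ Mᵀ *ᵥ x = x ⬝ᵥ M *ᵥ x := by
    rw [mulVec_transpose, dotProduct_comm, ← dotProduct_mulVec]
  rw [star_trivial, neg_mulVec, dotProduct_neg, add_mulVec, dotProduct_add, hsymm]
  linarith

end NumericalRange

section SpectralNorm

variable {n : ℕ}

theorem dotProduct_mulVec_le_norm2 (M : Matrix (Fin n) (Fin n) ℝ) (x : Fin n → ℝ) :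
    x ⬝ᵥ M *ᵥ x ≤ norm2 M * (x ⬝ᵥ x) := by
  have hnorm : x ⬝ᵥ x = ‖WithLp.toLp 2 x‖ * ‖WithLp.toLp 2 x‖ := by
    rw [← real_inner_self_eq_norm_mul_norm, EuclideanSpace.inner_toLp_toLp, star_trivial]
  calc x ⬝ᵥ M *ᵥ x = inner ℝ (WithLp.toLp 2 (M *ᵥ x)) (WithLp.toLp 2 x) := by
        rw [EuclideanSpace.inner_toLp_toLp, star_trivial]
    _ ≤ ‖WithLp.toLp 2 (M *ᵥ x)‖ * ‖WithLp.toLp 2 x‖ := real_inner_le_norm _ _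
    _ ≤ norm2 M * ‖WithLp.toLp 2 x‖ * ‖WithLp.toLp 2 x‖ := by
        gcongr
        exact (toEuclideanCLM (n := Fin n) (𝕜 := ℝ) M).le_opNorm (WithLp.toLp 2 x)
    _ = norm2 M * (x ⬝ᵥ x) := by rw [hnorm, mul_assoc]

theorem posSemidef_sub_lambdaMin {Q : Matrix (Fin n) (Fin n) ℝ} (hQ : Q.IsHermitian) :
    (Q - lambdaMin Q • 1).PosSemidef := by
  refine posSemidef_iff_isHermitian_and_spectrum_nonneg.mpr
    ⟨hQ.sub (isHermitian_one.smul (by simp [IsSelfAdjoint])), fun t ht => ?_⟩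
  rw [← Algebra.algebraMap_eq_smul_one, ← spectrum.sub_singleton_eq] at ht
  obtain ⟨a, ha, _, rfl, rfl⟩ := ht
  exact sub_nonneg.mpr (csInf_le finite_real_spectrum.bddBelow ha)

theorem posSemidef_sub_of_norm2_le_lambdaMin {Q R : Matrix (Fin n) (Fin n) ℝ}
    (hQ : Q.IsHermitian) (hR : R.IsHermitian) (h : norm2 R ≤ lambdaMin Q) :
    (Q - R).PosSemidef := by
  refine .of_dotProduct_mulVec_nonneg (hQ.sub hR) fun x => ?_
  have hlow := (posSemidef_sub_lambdaMin hQ).dotProduct_mulVec_nonneg x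
  simp only [star_trivial, sub_mulVec, dotProduct_sub, smul_mulVec, one_mulVec, dotProduct_smul,
    smul_eq_mul, sub_nonneg] at hlow ⊢
  calc x ⬝ᵥ R *ᵥ x ≤ norm2 R * (x ⬝ᵥ x) := dotProduct_mulVec_le_norm2 R x
    _ ≤ lambdaMin Q * (x ⬝ᵥ x) := by
        gcongr
        exact dotProduct_self_star_nonneg x
    _ ≤ x ⬝ᵥ Q *ᵥ x := hlow

open scoped Matrix.Norms.L2Operator in
theorem tendsto_zero_of_norm2_le_mul {R : ℕ → Matrix (Fin n) (Fin n) ℝ} {q : ℝ} (hq : q < 1)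
    (h : ∀ k, norm2 (R (k + 1)) ≤ q * norm2 (R k)) : Tendsto R atTop (𝓝 0) :=
  (summable_of_ratio_norm_eventually_le hq (.of_forall h)).tendsto_atTop_zero

end SpectralNorm

section Topology

variable {m n : Type*}

theorem isClosed_setOf_posSemidef [Finite n] :
    IsClosed {X : Matrix n n ℝ | X.PosSemidef} := by
  cases nonempty_fintype n
  simp only [posSemidef_iff_dotProduct_mulVec, Set.ofPred_and, Set.ofPred_forall]
  refine (isClosed_eq (by fun_prop) continuous_id).inter (isClosed_iInter fun x => ?_)
  exact isClosed_le continuous_const (by fun_prop)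

theorem isCompact_setOf_abs_apply_le (c : ℝ) :
    IsCompact {M : Matrix m n ℝ | ∀ i j, |M i j| ≤ c} := by
  have hbox : {M : Matrix m n ℝ | ∀ i j, |M i j| ≤ c} =
      Set.univ.pi fun _ => Set.univ.pi fun _ => Set.Icc (-c) c := by
    ext M
    simp only [Set.mem_ofPred_eq, abs_le]
    exact ⟨fun h i _ j _ => h i j, fun h i j => h i trivial j trivial⟩
  rw [hbox]
  exact isCompact_univ_pi fun _ => isCompact_univ_pi fun _ => isCompact_Icc

theorem sq_apply_le_trace_transpose_mul_self [Fintype m] [Fintype n] (M : Matrix m n ℝ) (i : m)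
    (j : n) : M i j ^ 2 ≤ (Mᵀ * M).trace := by
  have htrace : (Mᵀ * M).trace = ∑ b, ∑ a, M a b ^ 2 := by
    simp only [trace, diag_apply, mul_apply, transpose_apply, pow_two]
  calc M i j ^ 2 ≤ ∑ a, M a j ^ 2 :=
        Finset.single_le_sum (f := fun a => M a j ^ 2) (fun a _ => sq_nonneg _) (Finset.mem_univ i)
    _ ≤ ∑ b, ∑ a, M a b ^ 2 :=
        Finset.single_le_sum (f := fun b => ∑ a, M a b ^ 2)
          (fun b _ => Finset.sum_nonneg fun a _ => sq_nonneg _) (Finset.mem_univ j)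
    _ = (Mᵀ * M).trace := htrace.symm

end Topology

section Stable

variable {n : ℕ}

theorem isStable_iff_charpoly {M : Matrix (Fin n) (Fin n) ℝ} :
    IsStable M ↔ ∀ μ, (M.charpoly.map Complex.ofRealHom).IsRoot μ → μ.re < 0 := by
  simp only [IsStable, mem_spectrum_iff_isRoot_charpoly, ← charpoly_map]
  rfl

theorem isStable_transpose_iff {M : Matrix (Fin n) (Fin n) ℝ} : IsStable Mᵀ ↔ IsStable M := by
  rw [isStable_iff_charpoly, charpoly_transpose, isStable_iff_charpoly]

theorem isStable_conj_iff {L M : Matrix (Fin n) (Fin n) ℝ} (hL : IsUnit L) :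
    IsStable (L⁻¹ * M * L) ↔ IsStable M := by
  obtain ⟨u, rfl⟩ := hL
  rw [isStable_iff_charpoly, charpoly_units_conj', isStable_iff_charpoly]

theorem IsStable.disjoint_spectrum_neg {S T : Matrix (Fin n) (Fin n) ℝ} (hS : IsStable S)
    (hT : IsStable T) : Disjoint (spectrum ℂ (S.map Complex.ofRealHom))
      (spectrum ℂ ((-T).map Complex.ofRealHom)) := by
  refine Set.disjoint_left.mpr fun μ hμS hμT => ?_
  rw [← RingHom.mapMatrix_apply, map_neg, ← spectrum.neg_eq] at hμT
  have hpos := hT (-μ) hμT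
  rw [Complex.neg_re, neg_lt_zero] at hpos
  exact (hS μ hμS).not_gt hpos

end Stable

section Riccati

variable {n : ℕ} {A F Q X Y : Matrix (Fin n) (Fin n) ℝ}

theorem continuous_riccati (A F Q : Matrix (Fin n) (Fin n) ℝ) : Continuous (riccati A F Q) := by
  unfold riccati
  fun_prop

theorem isSymm_lyapunovResidual (hF : F.IsSymm) (hQ : Q.IsSymm) (hX : X.IsSymm) (hY : Y.IsSymm) :
    (lyapunovResidual A F Q X Y).IsSymm := by
  simp only [Matrix.IsSymm, lyapunovResidual, transpose_add, transpose_mul, transpose_transpose,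
    hF.eq, hQ.eq, hX.eq, hY.eq, Matrix.mul_assoc]
  abel

theorem posDef_of_riccati_eq_zero (hQ : Q.PosDef) (hX : X.PosSemidef)
    (h : riccati A F Q X = 0) : X.PosDef := by
  refine hX.posDef_iff_det_ne_zero.mpr fun hdet => ?_
  obtain ⟨v, hv, hXv⟩ := exists_mulVec_eq_zero_iff.mpr hdet
  have hvX : v ᵥ* X = 0 := by
    rw [← mulVec_transpose, (isHermitian_iff_isSymm.mp hX.isHermitian).eq, hXv]
  have hform : v ⬝ᵥ riccati A F Q X *ᵥ v = v ⬝ᵥ Q *ᵥ v := by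
    simp only [riccati, add_mulVec, sub_mulVec, dotProduct_add, ← mulVec_mulVec, hXv, mulVec_zero,
      dotProduct_mulVec v X, hvX, zero_dotProduct, sub_zero, zero_add]
  rw [h, zero_mulVec, dotProduct_zero] at hform
  exact (hQ.dotProduct_mulVec_pos hv).ne hform

theorem riccati_sub_riccati (hF : F.IsSymm) (hX : X.IsSymm) (A Q Y : Matrix (Fin n) (Fin n) ℝ) :
    riccati A F Q X - riccati A F Q Y =
      (closedLoop A F X)ᵀ * (X - Y) + (X - Y) * closedLoop A F Y := by
  simp only [closedLoop, riccati, transpose_sub, transpose_mul, hF.eq, hX.eq]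
  noncomm_ring

theorem IsStabilizingSolution.eq (hF : F.IsSymm) (hXs : X.IsSymm)
    (hX : IsStabilizingSolution A F Q X) (hY : IsStabilizingSolution A F Q Y) : Y = X := by
  have hsylv : (closedLoop A F X)ᵀ * (X - Y) = (X - Y) * -closedLoop A F Y := by
    rw [mul_neg]
    exact eq_neg_of_add_eq_zero_left (by rw [← riccati_sub_riccati hF hXs, hX.1, hY.1, sub_zero])
  have hzero : (X - Y).map Complex.ofRealHom = 0 :=
    eq_zero_of_mul_eq_mul_of_disjoint_spectrum
      ((isStable_transpose_iff.mpr hX.2).disjoint_spectrum_neg hY.2)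
      (by rw [← Matrix.map_mul, hsylv, Matrix.map_mul])
  have hXY : X - Y = 0 := map_injective Complex.ofReal_injective (hzero.trans (by simp))
  exact (sub_eq_zero.mp hXY).symm

end Riccati

section UnitQuadraticTerm

variable {n : ℕ} {B Q : Matrix (Fin n) (Fin n) ℝ}

theorem posDef_neg_add_transpose_closedLoop (hB : (-(B + Bᵀ)).PosDef)
    {X : Matrix (Fin n) (Fin n) ℝ} (hX : X.PosSemidef) :
    (-(closedLoop B 1 X + (closedLoop B 1 X)ᵀ)).PosDef := by
  have heq : -(closedLoop B 1 X + (closedLoop B 1 X)ᵀ) = -(B + Bᵀ) + (X + X) := by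
    rw [closedLoop, Matrix.one_mul, transpose_sub,
      (isHermitian_iff_isSymm.mp hX.isHermitian).eq]
    abel
  exact heq ▸ hB.add_posSemidef (hX.add hX)

theorem posSemidef_of_posSemidef_sub_lyapunovResidual (hB : (-(B + Bᵀ)).PosDef)
    {X Y : Matrix (Fin n) (Fin n) ℝ} (hX : X.PosSemidef) (hY : Y.IsSymm)
    (h : (Q - lyapunovResidual B 1 Q X Y).PosSemidef) : Y.PosSemidef := by
  refine posSemidef_of_lyapunov (C := closedLoop B 1 X)
    (posDef_neg_add_transpose_closedLoop hB hX) (isHermitian_iff_isSymm.mpr hY) ?_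
  have hXX : (X * X).PosSemidef := by
    simpa only [hX.isHermitian.eq] using posSemidef_conjTranspose_mul_self X
  have heq : -((closedLoop B 1 X)ᴴ * Y + Y * closedLoop B 1 X) =
      X * X + (Q - lyapunovResidual B 1 Q X Y) := by
    simp only [lyapunovResidual, conjTranspose_eq_transpose_of_trivial, Matrix.mul_one]
    abel
  exact heq ▸ hXX.add h

theorem sq_apply_le_trace_sub_riccati (hB : (-(B + Bᵀ)).PosDef) {X : Matrix (Fin n) (Fin n) ℝ}
    (hX : X.PosSemidef) (i j : Fin n) : X i j ^ 2 ≤ (Q - riccati B 1 Q X).trace := by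
  have htrace : (Q - riccati B 1 Q X).trace = (Xᵀ * X).trace + (-(B + Bᵀ) * X).trace := by
    rw [(isHermitian_iff_isSymm.mp hX.isHermitian).eq, riccati, neg_mul, add_mul, Matrix.mul_one]
    simp only [trace_add, trace_sub, trace_neg, trace_mul_comm X B]
    ring
  calc X i j ^ 2 ≤ (Xᵀ * X).trace := sq_apply_le_trace_transpose_mul_self X i j
    _ ≤ (Xᵀ * X).trace + (-(B + Bᵀ) * X).trace :=
        le_add_of_nonneg_right (trace_mul_nonneg_of_posSemidef hB.posSemidef hX)
    _ = (Q - riccati B 1 Q X).trace := htrace.symm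

variable {X : ℕ → Matrix (Fin n) (Fin n) ℝ}

theorem exists_isCompact_of_tendsto_riccati (hB : (-(B + Bᵀ)).PosDef)
    (hX : ∀ k, (X k).PosSemidef) (hR : Tendsto (fun k => riccati B 1 Q (X k)) atTop (𝓝 0)) :
    ∃ K, IsCompact K ∧ ∀ k, X k ∈ K := by
  have hcont : Continuous fun R : Matrix (Fin n) (Fin n) ℝ => (Q - R).trace := by fun_prop
  obtain ⟨c, hc⟩ := ((hcont.tendsto 0).comp hR).bddAbove_range
  exact ⟨_, isCompact_setOf_abs_apply_le √c, fun k i j => Real.abs_le_sqrt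
    ((sq_apply_le_trace_sub_riccati hB (hX k) i j).trans (hc ⟨k, rfl⟩))⟩

theorem posSemidef_and_isStabilizingSolution_of_mapClusterPt (hB : (-(B + Bᵀ)).PosDef)
    (hX : ∀ k, (X k).PosSemidef) (hR : Tendsto (fun k => riccati B 1 Q (X k)) atTop (𝓝 0))
    {Z : Matrix (Fin n) (Fin n) ℝ} (hZ : MapClusterPt Z atTop X) :
    Z.PosSemidef ∧ IsStabilizingSolution B 1 Q Z := by
  have hpsd : Z.PosSemidef :=
    isClosed_setOf_posSemidef.mem_of_mapClusterPt hZ (.of_forall hX)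
  have hcluster : MapClusterPt (riccati B 1 Q Z) atTop (riccati B 1 Q ∘ X) :=
    hZ.continuousAt_comp (continuous_riccati B 1 Q).continuousAt
  have : (𝓝 (riccati B 1 Q Z) ⊓ 𝓝 0).NeBot := NeBot.mono hcluster (inf_le_inf_left _ hR)
  exact ⟨hpsd, eq_of_nhds_neBot this,
    isStable_of_posDef_neg_add_transpose (posDef_neg_add_transpose_closedLoop hB hpsd)⟩

theorem exists_posDef_isStabilizingSolution_tendsto (hB : (-(B + Bᵀ)).PosDef) (hQ : Q.PosDef)
    (hX : ∀ k, (X k).PosSemidef) (hR : Tendsto (fun k => riccati B 1 Q (X k)) atTop (𝓝 0)) :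
    ∃ Z, Z.PosDef ∧ IsStabilizingSolution B 1 Q Z ∧ Tendsto X atTop (𝓝 Z) := by
  obtain ⟨K, hK, hXK⟩ := exists_isCompact_of_tendsto_riccati hB hX hR
  obtain ⟨Z, -, hZ⟩ := hK.exists_mapClusterPt (f := atTop) (u := X)
    (tendsto_principal.mpr (.of_forall hXK))
  have hsol {Y} (hY : MapClusterPt Y atTop X) :=
    posSemidef_and_isStabilizingSolution_of_mapClusterPt hB hX hR hY
  have hZs : Z.IsSymm := isHermitian_iff_isSymm.mp (hsol hZ).1.isHermitian
  exact ⟨Z, posDef_of_riccati_eq_zero hQ (hsol hZ).1 (hsol hZ).2.1, (hsol hZ).2,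
    hK.tendsto_nhds_of_unique_mapClusterPt (.of_forall hXK) fun Y _ hY =>
      (hsol hZ).2.eq isSymm_one hZs (hsol hY).2⟩

end UnitQuadraticTerm

section Congruence

variable {ι R : Type*} [Fintype ι] [DecidableEq ι]

theorem posSemidef_congruence_iff {L X : Matrix ι ι ℝ} (hL : IsUnit L) :
    (Lᵀ * X * L).PosSemidef ↔ X.PosSemidef := by
  simpa only [star_eq_conjTranspose, conjTranspose_eq_transpose_of_trivial] using
    hL.posSemidef_star_left_conjugate_iff (x := X)

theorem posDef_congruence_iff {L X : Matrix ι ι ℝ} (hL : IsUnit L) :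
    (Lᵀ * X * L).PosDef ↔ X.PosDef := by
  simpa only [star_eq_conjTranspose, conjTranspose_eq_transpose_of_trivial] using
    hL.posDef_star_left_conjugate_iff (x := X)

variable [CommRing R] {L : Matrix ι ι R}

theorem inv_congruence_congruence (hL : IsUnit L) (X : Matrix ι ι R) :
    L⁻¹ᵀ * (Lᵀ * X * L) * L⁻¹ = X := by
  have hdet := (isUnit_iff_isUnit_det L).mp hL
  have hdetT : IsUnit Lᵀ.det := by rwa [det_transpose]
  rw [transpose_nonsing_inv, Matrix.mul_assoc Lᵀ, nonsing_inv_mul_cancel_left _ _ hdetT,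
    mul_nonsing_inv_cancel_right _ _ hdet]

theorem exists_congruence_eq (hL : IsUnit L) (Z : Matrix ι ι R) : ∃ X, Lᵀ * X * L = Z := by
  have h := inv_congruence_congruence (isUnit_nonsing_inv_iff.mpr hL) Z
  rw [nonsing_inv_nonsing_inv _ ((isUnit_iff_isUnit_det L).mp hL)] at h
  exact ⟨_, h⟩

theorem tendsto_of_tendsto_congruence [TopologicalSpace R] [IsTopologicalSemiring R]
    (hL : IsUnit L) {κ : Type*} {l : Filter κ} {X : κ → Matrix ι ι R} {Z : Matrix ι ι R}
    (h : Tendsto (fun k => Lᵀ * X k * L) l (𝓝 (Lᵀ * Z * L))) : Tendsto X l (𝓝 Z) := by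
  have hcont : Continuous fun Y : Matrix ι ι R => L⁻¹ᵀ * Y * L⁻¹ := by fun_prop
  simpa only [Function.comp_def, inv_congruence_congruence hL] using (hcont.tendsto _).comp h

end Congruence

section RiccatiCongruence

variable {n : ℕ} {A Q L : Matrix (Fin n) (Fin n) ℝ}

theorem closedLoop_congruence (hL : IsUnit L) (A X : Matrix (Fin n) (Fin n) ℝ) :
    closedLoop (L⁻¹ * A * L) 1 (Lᵀ * X * L) = L⁻¹ * closedLoop A (L * Lᵀ) X * L := by
  have hdet := (isUnit_iff_isUnit_det L).mp hL
  simp only [closedLoop, mul_sub, sub_mul, Matrix.one_mul, Matrix.mul_assoc,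
    nonsing_inv_mul_cancel_left _ _ hdet]

theorem lyapunovResidual_congruence (hL : IsUnit L) (A Q X Y : Matrix (Fin n) (Fin n) ℝ) :
    lyapunovResidual (L⁻¹ * A * L) 1 (Lᵀ * Q * L) (Lᵀ * X * L) (Lᵀ * Y * L) =
      Lᵀ * lyapunovResidual A (L * Lᵀ) Q X Y * L := by
  have hdet := (isUnit_iff_isUnit_det L).mp hL
  have hdetT : IsUnit Lᵀ.det := by rwa [det_transpose]
  rw [lyapunovResidual, closedLoop_congruence hL]
  simp only [lyapunovResidual, transpose_mul, transpose_nonsing_inv, mul_add, add_mul,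
    Matrix.one_mul, Matrix.mul_assoc, nonsing_inv_mul_cancel_left _ _ hdetT,
    mul_nonsing_inv_cancel_left _ _ hdet]

theorem riccati_congruence (hL : IsUnit L) (A Q X : Matrix (Fin n) (Fin n) ℝ) :
    riccati (L⁻¹ * A * L) 1 (Lᵀ * Q * L) (Lᵀ * X * L) = Lᵀ * riccati A (L * Lᵀ) Q X * L := by
  have hdet := (isUnit_iff_isUnit_det L).mp hL
  have hdetT : IsUnit Lᵀ.det := by rwa [det_transpose]
  simp only [riccati, transpose_mul, transpose_nonsing_inv, mul_add, add_mul, mul_sub, sub_mul,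
    Matrix.one_mul, Matrix.mul_assoc, nonsing_inv_mul_cancel_left _ _ hdetT,
    mul_nonsing_inv_cancel_left _ _ hdet]

theorem isStabilizingSolution_congruence_iff (hL : IsUnit L) {X : Matrix (Fin n) (Fin n) ℝ} :
    IsStabilizingSolution (L⁻¹ * A * L) 1 (Lᵀ * Q * L) (Lᵀ * X * L) ↔
      IsStabilizingSolution A (L * Lᵀ) Q X := by
  have hLT : IsUnit Lᵀ := (isUnit_transpose L).mpr hL
  simp only [IsStabilizingSolution, riccati_congruence hL, closedLoop_congruence hL,
    isStable_conj_iff hL, hL.mul_left_eq_zero, hLT.mul_right_eq_zero]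

theorem posSemidef_of_norm2_lyapunovResidual_le (hL : IsUnit L)
    (hB : (-(L⁻¹ * A * L + (L⁻¹ * A * L)ᵀ)).PosDef) (hQ : Q.IsHermitian)
    {X Y : Matrix (Fin n) (Fin n) ℝ} (hX : X.PosSemidef) (hY : Y.IsSymm)
    (h : norm2 (lyapunovResidual A (L * Lᵀ) Q X Y) ≤ lambdaMin Q) : Y.PosSemidef := by
  have hres : (lyapunovResidual A (L * Lᵀ) Q X Y).IsHermitian :=
    isHermitian_iff_isSymm.mpr (isSymm_lyapunovResidual (isSymm_mul_transpose_self L)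
      (isHermitian_iff_isSymm.mp hQ) (isHermitian_iff_isSymm.mp hX.isHermitian) hY)
  have hdiff := (posSemidef_congruence_iff hL).mpr
    (posSemidef_sub_of_norm2_le_lambdaMin hQ hres h)
  rw [mul_sub, sub_mul, ← lyapunovResidual_congruence hL] at hdiff
  have hLYL : (Lᵀ * Y * L).IsSymm := by simp [Matrix.IsSymm, hY.eq, Matrix.mul_assoc]
  exact (posSemidef_congruence_iff hL).mp (posSemidef_of_posSemidef_sub_lyapunovResidual hB
    ((posSemidef_congruence_iff hL).mpr hX) hLYL hdiff)

end RiccatiCongruence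

end TINK

theorem corollary3p3_general {n : ℕ} {A F Q L : Matrix (Fin n) (Fin n) ℝ}
    {X : ℕ → Matrix (Fin n) (Fin n) ℝ} (hF : F.PosDef) (hL : F = L * Lᵀ) (hQ : Q.PosDef)
    (hW : ∀ z ∈ TINK.numericalRange (L⁻¹ * A * L), z.re < 0)
    (hX₀ : (X 0).PosSemidef) (hX : ∀ k, (X k).IsSymm)
    (hcare : Tendsto (fun k => TINK.riccati A F Q (X k)) atTop (𝓝 0))
    (hlyap : ∀ k, TINK.norm2 (TINK.lyapunovResidual A F Q (X k) (X (k + 1))) ≤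
      TINK.lambdaMin Q) :
    ∃ Xstar : Matrix (Fin n) (Fin n) ℝ,
      Xstar.PosDef ∧ TINK.IsStabilizingSolution A F Q Xstar ∧
      (∀ Y : Matrix (Fin n) (Fin n) ℝ, TINK.IsStabilizingSolution A F Q Y → Y = Xstar) ∧
      Tendsto X atTop (𝓝 Xstar) := by
  subst hL
  have hLu : IsUnit L := isUnit_of_mul_isUnit_left hF.isUnit
  have hB := TINK.posDef_neg_add_transpose_of_numericalRange hW
  have hpsd (k : ℕ) : (X k).PosSemidef := by
    induction k with
    | zero => exact hX₀
    | succ k ih =>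
      exact TINK.posSemidef_of_norm2_lyapunovResidual_le hLu hB hQ.1 ih (hX _) (hlyap k)
  have hres : Tendsto (fun k => TINK.riccati (L⁻¹ * A * L) 1 (Lᵀ * Q * L) (Lᵀ * X k * L)) atTop
      (𝓝 0) := by
    simpa [TINK.riccati_congruence hLu] using (hcare.const_mul Lᵀ).mul_const L
  obtain ⟨Z, hZ, hsol, hlim⟩ := TINK.exists_posDef_isStabilizingSolution_tendsto hB
    ((TINK.posDef_congruence_iff hLu).mpr hQ)
    (fun k => (TINK.posSemidef_congruence_iff hLu).mpr (hpsd k)) hres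
  obtain ⟨Xstar, rfl⟩ := TINK.exists_congruence_eq hLu Z
  have hpos : Xstar.PosDef := (TINK.posDef_congruence_iff hLu).mp hZ
  rw [TINK.isStabilizingSolution_congruence_iff hLu] at hsol
  exact ⟨Xstar, hpos, hsol, fun Y => hsol.eq (isSymm_mul_transpose_self L)
    (isHermitian_iff_isSymm.mp hpos.1), TINK.tendsto_of_tendsto_congruence hLu hlim⟩

theorem corollary3p3 {n : ℕ} (A F Q L X₀ : Matrix (Fin n) (Fin n) ℝ)
    (hF : F.PosDef) (hL : F = L * Lᵀ) (hQ : Q.PosDef)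
    (hW : ∀ z ∈ TINK.numericalRange (L⁻¹ * A * L), z.re < 0)
    (hX₀ : X₀.PosSemidef) (hstab : TINK.IsStable (TINK.closedLoop A F X₀))
    (linesearch : Bool) (α : ℝ) (hα : 0 < α)
    (it s : ℕ → ℕ) (lam : ℕ → ℝ) (Xhat X : ℕ → Matrix (Fin n) (Fin n) ℝ)
    (hrun : TINK.IsRun A F Q X₀ linesearch α it s lam Xhat X)
    (lamBar : ℝ) (hlamBar : 0 < lamBar) (hlam : ∀ k, lamBar ≤ lam k)
    (ζ : ℝ) (hζ0 : 0 < ζ) (hζ1 : ζ < 1)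
    (hcare : ∀ k, TINK.norm2 (TINK.riccati A F Q
        (TINK.bandTruncation (s k) ((1 - lam k) • X k + lam k • Xhat (k + 1)))) ≤
      (1 - ζ) * TINK.norm2 (TINK.riccati A F Q (X k)))
    (hlyap : ∀ k, TINK.norm2 (TINK.lyapunovResidual A F Q (X k)
        (TINK.bandTruncation (s k) ((1 - lam k) • X k + lam k • Xhat (k + 1)))) ≤
      TINK.lambdaMin Q) :
    ∃ Xstar : Matrix (Fin n) (Fin n) ℝ,
      Xstar.PosDef ∧ TINK.IsStabilizingSolution A F Q Xstar ∧
      (∀ Y : Matrix (Fin n) (Fin n) ℝ, TINK.IsStabilizingSolution A F Q Y → Y = Xstar) ∧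
      Tendsto X atTop (𝓝 Xstar) := by
  simp only [← hrun.update] at hcare hlyap
  have hX := hrun.isSymm (isHermitian_iff_isSymm.mp hF.1) (isHermitian_iff_isSymm.mp hQ.1)
    (isHermitian_iff_isSymm.mp hX₀.1)
  exact corollary3p3_general hF hL hQ hW (hrun.init ▸ hX₀) hX
    (TINK.tendsto_zero_of_norm2_le_mul (sub_lt_self 1 hζ0) hcare) hlyap
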